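/- Let $K$ be a field and let $q\in K$ with $q\neq 0$, $q\neq 1$ (for instance $K=\mathbb{Q}(q)$ with $q$ an indeterminate). Let $v$ be a formal variable. In the ring $K[[v]]\subset K((v))$ of formal power series, the infinite continued fraction $$\cfrac{1}{1+v-\cfrac{(1-q)(1-q^2)v}{1+v-\cfrac{(1-q^2)(1-q^3)v}{1+v-\cdots}}}$$ (whose $k$-th partial numerator for $k\ge 1$ is $-(1-q^k)(1-q^{k+1})v$) converges, in the sense that its finite convergents converge in the $v$-adic topology, and its value is $$\frac{1}{1-q}\sum_{N\ge0}v^Nq^{N(N+1)}\sum_{n=-N}^{N}(1-q^{n+N+1})(-1)^{n}q^{-n(n+1)}-\frac{1}{1-q}\sum_{N\ge0}v^{N}q^{N^2}\sum_{n=-N}^{N}(1-q^{n+N})(-1)^{n}q^{-n^2}.$$ -/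

import Mathlib

open Filter
open scoped Topology PowerSeries LaurentSeries

noncomputable section

namespace TouchardCF

/-- The formal variable `v`, as an element of the field `K((v))` of formal Laurent series. -/
def v (K : Type*) [Field K] : K⸨X⸩ := ((PowerSeries.X : K⟦X⟧) : K⸨X⸩)

/-- The `i`-th coefficient `(1 - q^i)(1 - q^(i+1))` of the continued fraction. -/
def coef {K : Type*} [Field K] (q : K) (i : ℕ) : K := (1 - q ^ i) * (1 - q ^ (i + 1))

/-- The `k`-th partial numerator: `1` for `k = 0`, and `-(1 - q^k)(1 - q^(k+1)) v` for `k ≥ 1`. -/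
def partialNum {K : Type*} [Field K] (q : K) : ℕ → K⸨X⸩
  | 0 => 1
  | k + 1 => -(HahnSeries.C (coef q (k + 1)) * v K)

/-- The infinite continued fraction over `K((v))`
`1 / (1 + v - (1-q)(1-q^2) v / (1 + v - (1-q^2)(1-q^3) v / ...))`:
head term `0`, partial numerators `partialNum q k`, and all partial denominators `1 + v`. -/
def contFrac {K : Type*} [Field K] (q : K) : GenContFract K⸨X⸩ where
  h := 0
  s := Stream'.Seq.ofStream fun k : ℕ => ⟨partialNum q k, 1 + v K⟩

/-- `∑_{N ≥ 0} v^N q^(N(N+1)) ∑_{-N ≤ n ≤ N} (1 - q^(n+N+1)) (-1)^n q^(-n(n+1))`. -/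
def firstSeries {K : Type*} [Field K] (q : K) : K⟦X⟧ :=
  PowerSeries.mk fun N : ℕ =>
    q ^ (N * (N + 1)) * ∑ n ∈ Finset.Icc (-(N : ℤ)) (N : ℤ),
      (1 - q ^ (n + (N : ℤ) + 1)) * (-1 : K) ^ n * q ^ (-(n * (n + 1)))

/-- `∑_{N ≥ 0} v^N q^(N^2) ∑_{-N ≤ n ≤ N} (1 - q^(n+N)) (-1)^n q^(-n^2)`. -/
def secondSeries {K : Type*} [Field K] (q : K) : K⟦X⟧ :=
  PowerSeries.mk fun N : ℕ =>
    q ^ (N ^ 2) * ∑ n ∈ Finset.Icc (-(N : ℤ)) (N : ℤ),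
      (1 - q ^ (n + (N : ℤ))) * (-1 : K) ^ n * q ^ (-(n ^ 2))

end TouchardCF

end

namespace TouchardCF

/-! ### Tail sequences -/

open PowerSeries

variable {K : Type*} [Field K]

/-! Let `E 0 = 1, E 1, ...` be the tail sequence for `coef q`; formally, the fraction is `E 1 / E 0
= E 1`. Since `coef q 0 = 0`, `tailSeq_contiguous` relates `E` to its dilation `X ↦ q ^ 2 * X`,
which at `k = 1` becomes a `q`-difference equation for `E 1` alone. The stated series solves it too,
by the recurrence for partial theta sums, and the solution is unique (`eq_of_functional`).
Convergence follows from `contFrac_error`: the error is divisible by `v ^ n`. -/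

/-- A sequence of power series whose consecutive quotients `E (k + 1) / E k` are the tails of the
continued fraction `1 / (1 + X - c 1 * X / (1 + X - c 2 * X / ⋯))`. -/
def IsTailSeq (c : ℕ → K) (E : ℕ → K⟦X⟧) : Prop :=
  ∀ k, E k = (1 + X) * E (k + 1) - C (c (k + 1)) * X * E (k + 2)

/-- The coefficients of the tail sequence starting with `1`. -/
def tailCoeff (c : ℕ → K) : ℕ → ℕ → K
  | 0 => fun _ => 1
  | N + 1 => fun k => Nat.rec 0
      (fun k a => a - tailCoeff c N (k + 1) + c (k + 1) * tailCoeff c N (k + 2)) k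

/-- The tail sequence starting with `1`. -/
def tailSeq (c : ℕ → K) (k : ℕ) : K⟦X⟧ := PowerSeries.mk fun N => tailCoeff c N k

theorem tailSeq_zero (c : ℕ → K) : tailSeq c 0 = 1 := by
  ext (_ | N) <;> simp [tailSeq, tailCoeff, coeff_one]

theorem isTailSeq_tailSeq (c : ℕ → K) : IsTailSeq c (tailSeq c) := by
  intro k
  ext (_ | N)
  · simp [tailSeq, tailCoeff, add_mul, mul_assoc]
  · simp only [tailSeq, tailCoeff, add_mul, one_mul, mul_assoc, map_sub, map_add, coeff_mk,
      coeff_succ_X_mul, coeff_C_mul]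
    ring

/-- In degree `N`, the recurrence gives the coefficient of `E (k + 1)` from that of `E k` and
coefficients of degree `N - 1`. -/
theorem IsTailSeq.eq_of_zero_eq {c : ℕ → K} {E F : ℕ → K⟦X⟧} (hE : IsTailSeq c E)
    (hF : IsTailSeq c F) (h : E 0 = F 0) : E = F := by
  suffices H : ∀ N k, coeff N (E k) = coeff N (F k) from
    funext fun k => PowerSeries.ext fun N => H N k
  intro N
  induction N with
  | zero =>
    intro k
    induction k with
    | zero => rw [h]
    | succ k ih =>
      rw [hE k, hF k] at ih
      simpa [add_mul, mul_assoc] using ih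
  | succ N ihN =>
    intro k
    induction k with
    | zero => rw [h]
    | succ k ih =>
      rw [hE k, hF k] at ih
      simp only [add_mul, one_mul, mul_assoc, map_sub, map_add, coeff_succ_X_mul, coeff_C_mul,
        ihN] at ih
      linear_combination ih

theorem rescale_C (a b : K) : rescale a (C b) = C b := by
  ext n
  rw [coeff_rescale, coeff_C]
  split_ifs with h <;> simp [h]

/-- A contiguous relation between the tail sequence and its dilation by `q ^ 2`. -/
theorem tailSeq_contiguous (q : K) (k : ℕ) :
    (1 + C (q ^ 2) * X) * tailSeq (coef q) k =
      (1 - C q * X + C (q * (1 + q) * q ^ k) * X) * rescale (q ^ 2) (tailSeq (coef q) k)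
        - C (coef q k * q ^ 2) * X * (1 - C q * X) *
          rescale (q ^ 2) (tailSeq (coef q) (k + 1)) := by
  set E := tailSeq (coef q) with hE
  have hrec : IsTailSeq (coef q) E := isTailSeq_tailSeq _
  have hR : ∀ k, rescale (q ^ 2) (E k) = (1 + C (q ^ 2) * X) * rescale (q ^ 2) (E (k + 1)) -
      C (coef q (k + 1) * q ^ 2) * X * rescale (q ^ 2) (E (k + 2)) := by
    intro k
    conv_lhs => rw [hrec k]
    simp only [map_sub, map_mul, map_add, map_one, rescale_X, rescale_C]
    ring
  -- Both sides are tail sequences in `k`; at `k = 0` they agree because `coef q 0 = 0`.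
  refine congrFun (IsTailSeq.eq_of_zero_eq (c := coef q)
    (E := fun k => (1 + C (q ^ 2) * X) * E k)
    (F := fun k => (1 - C q * X + C (q * (1 + q) * q ^ k) * X) * rescale (q ^ 2) (E k)
        - C (coef q k * q ^ 2) * X * (1 - C q * X) * rescale (q ^ 2) (E (k + 1))) ?_ ?_ ?_) k
  · intro k
    linear_combination (1 + C (q ^ 2) * X) * hrec k
  · intro k
    have h0 := hR k
    have h1 := hR (k + 1)
    simp only [coef, map_sub, map_mul, map_add, map_one, map_pow, pow_succ] at h0 h1 ⊢
    linear_combination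
      (1 - C q * X + C q * (1 + C q) * C q ^ k * X) * h0 -
        (1 - C q ^ k * C q) * (1 - C q ^ k * C q * C q) * X * (1 - C q * X) * h1
  · simp only [hE, tailSeq_zero, coef, map_one]
    simp
    ring

/-- The dilated recurrence at `k = 0` eliminates `E 2` from the contiguous relation at `k = 1`. -/
theorem tailSeq_one_functional (q : K) :
    (1 + C (q ^ 2) * X) * tailSeq (coef q) 1 =
      C (q ^ 3) * X * (1 + X) * rescale (q ^ 2) (tailSeq (coef q) 1) + (1 - C q * X) := by
  have h := tailSeq_contiguous q 1
  have h0 := congrArg (rescale (q ^ 2)) (isTailSeq_tailSeq (coef q) 0)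
  simp only [tailSeq_zero, map_sub, map_mul, map_add, map_one, rescale_X, rescale_C, map_pow,
    zero_add, pow_one] at h h0 ⊢
  linear_combination h - (1 - C q * X) * h0

/-! ### Partial theta sums and the stated value -/

/-- The normalised partial theta sum `q ^ (N ^ 2) * ∑ |n| ≤ N, (-1) ^ n * q ^ (-n ^ 2)`. -/
noncomputable def thetaSum (q : K) (N : ℕ) : K :=
  q ^ (N ^ 2) * ∑ n ∈ Finset.Icc (-(N : ℤ)) (N : ℤ), (-1 : K) ^ n * q ^ (-(n ^ 2))

theorem sum_Icc_neg_succ {M : Type*} [AddCommMonoid M] (f : ℤ → M) (N : ℕ) :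
    ∑ n ∈ Finset.Icc (-((N + 1 : ℕ) : ℤ)) ((N + 1 : ℕ) : ℤ), f n =
      f (-((N + 1 : ℕ) : ℤ)) + f ((N + 1 : ℕ) : ℤ) +
        ∑ n ∈ Finset.Icc (-(N : ℤ)) (N : ℤ), f n := by
  have h : Finset.Icc (-((N + 1 : ℕ) : ℤ)) ((N + 1 : ℕ) : ℤ) =
      insert (-((N + 1 : ℕ) : ℤ)) (insert ((N + 1 : ℕ) : ℤ) (Finset.Icc (-(N : ℤ)) (N : ℤ))) := by
    ext n
    simp only [Finset.mem_Icc, Finset.mem_insert]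
    omega
  rw [h, Finset.sum_insert, Finset.sum_insert, add_assoc]
  · simp
  · simp only [Finset.mem_Icc, Finset.mem_insert]
    omega

theorem neg_one_zpow_neg (n : ℤ) : (-1 : K) ^ (-n) = (-1) ^ n := by
  rw [zpow_neg, ← inv_zpow, inv_neg, inv_one]

theorem thetaSum_zero (q : K) : thetaSum q 0 = 1 := by simp [thetaSum]

theorem thetaSum_succ {q : K} (hq : q ≠ 0) (N : ℕ) :
    thetaSum q (N + 1) = q ^ (2 * N + 1) * thetaSum q N + 2 * (-1) ^ (N + 1) := by
  have h : q ^ ((N + 1) ^ 2) * q ^ (-(((N + 1 : ℕ) : ℤ) ^ 2)) = 1 := by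
    rw [← zpow_natCast, ← zpow_add₀ hq]
    simp
  rw [thetaSum, sum_Icc_neg_succ, neg_one_zpow_neg, neg_sq, zpow_natCast, thetaSum]
  linear_combination (2 * (-1) ^ (N + 1)) * h

/-- The terms at `n` and `-n - 1` cancel, leaving only `n = N`. -/
theorem sum_alternating_pronic {q : K} (hq : q ≠ 0) (N : ℕ) :
    q ^ (N * (N + 1)) *
      ∑ n ∈ Finset.Icc (-(N : ℤ)) (N : ℤ), (-1 : K) ^ n * q ^ (-(n * (n + 1))) = (-1) ^ N := by
  have key : ∑ n ∈ Finset.Icc (-(N : ℤ)) (N : ℤ), (-1 : K) ^ n * q ^ (-(n * (n + 1))) =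
      (-1) ^ N * q ^ (-((N : ℤ) * (N + 1))) := by
    induction N with
    | zero => simp
    | succ N ih =>
      rw [sum_Icc_neg_succ, ih, neg_one_zpow_neg, zpow_natCast,
        show -(-((N + 1 : ℕ) : ℤ) * (-((N + 1 : ℕ) : ℤ) + 1)) = -((N : ℤ) * (N + 1)) by
          push_cast; ring]
      ring
  rw [key, mul_left_comm, ← zpow_natCast q, ← zpow_add₀ hq]
  simp

theorem firstSeries_coeff {q : K} (hq : q ≠ 0) (N : ℕ) :
    coeff N (firstSeries q) = (-1) ^ N - q ^ (2 * N + 1) * thetaSum q N := by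
  have h : ∀ n : ℤ, (1 - q ^ (n + (N : ℤ) + 1)) * (-1 : K) ^ n * q ^ (-(n * (n + 1))) =
      (-1 : K) ^ n * q ^ (-(n * (n + 1))) - q ^ (N + 1) * ((-1 : K) ^ n * q ^ (-(n ^ 2))) := by
    intro n
    have : q ^ (n + (N : ℤ) + 1) * q ^ (-(n * (n + 1))) = q ^ (N + 1) * q ^ (-(n ^ 2)) := by
      rw [← zpow_natCast q, ← zpow_add₀ hq, ← zpow_add₀ hq]
      congr 1
      push_cast
      ring
    linear_combination -(-1 : K) ^ n * this
  rw [firstSeries, coeff_mk, Finset.sum_congr rfl fun n _ => h n, Finset.sum_sub_distrib,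
    ← Finset.mul_sum, mul_sub, sum_alternating_pronic hq, thetaSum]
  ring

theorem secondSeries_coeff {q : K} (hq : q ≠ 0) (N : ℕ) :
    coeff N (secondSeries q) = thetaSum q N - (-1) ^ N := by
  have h : ∀ n : ℤ, (1 - q ^ (n + (N : ℤ))) * (-1 : K) ^ n * q ^ (-(n ^ 2)) =
      (-1 : K) ^ n * q ^ (-(n ^ 2)) -
        q ^ N * ((-1 : K) ^ (-n) * q ^ (-(-n * (-n + 1)))) := by
    intro n
    have : q ^ (n + (N : ℤ)) * q ^ (-(n ^ 2)) = q ^ N * q ^ (-(-n * (-n + 1))) := by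
      rw [← zpow_natCast q, ← zpow_add₀ hq, ← zpow_add₀ hq]
      congr 1
      ring
    rw [neg_one_zpow_neg]
    linear_combination -(-1 : K) ^ n * this
  have hneg : ∑ n ∈ Finset.Icc (-(N : ℤ)) (N : ℤ), (-1 : K) ^ (-n) * q ^ (-(-n * (-n + 1))) =
      ∑ n ∈ Finset.Icc (-(N : ℤ)) (N : ℤ), (-1 : K) ^ n * q ^ (-(n * (n + 1))) :=
    Finset.sum_nbij' (fun n => -n) (fun n => -n) (by simp; omega) (by simp; omega)
      (by simp) (by simp) (by simp)
  rw [secondSeries, coeff_mk, Finset.sum_congr rfl fun n _ => h n, Finset.sum_sub_distrib,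
    ← Finset.mul_sum, hneg, mul_sub, ← sum_alternating_pronic hq N, thetaSum]
  ring

/-- The value of the continued fraction. -/
noncomputable def value (q : K) : K⟦X⟧ :=
  C (1 / (1 - q)) * firstSeries q - C (1 / (1 - q)) * secondSeries q

theorem value_coeff {q : K} (hq : q ≠ 0) (N : ℕ) :
    coeff N (value q) =
      1 / (1 - q) * (2 * (-1) ^ N - (1 + q ^ (2 * N + 1)) * thetaSum q N) := by
  rw [value, map_sub, coeff_C_mul, coeff_C_mul, firstSeries_coeff hq, secondSeries_coeff hq]
  ring

theorem value_functional {q : K} (hq0 : q ≠ 0) (hq1 : q ≠ 1) :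
    (1 + C (q ^ 2) * X) * value q =
      C (q ^ 3) * X * (1 + X) * rescale (q ^ 2) (value q) + (1 - C q * X) := by
  have h1 : 1 - q ≠ 0 := sub_ne_zero.2 hq1.symm
  have e : ∀ f : K⟦X⟧, C (q ^ 3) * X * (1 + X) * f = C (q ^ 3) * (X * (f + X * f)) := by
    intro f; ring
  rw [e]
  ext (_ | _ | N)
  · rw [coeff_zero_eq_constantCoeff_apply, coeff_zero_eq_constantCoeff_apply]
    have h := value_coeff hq0 0
    rw [coeff_zero_eq_constantCoeff_apply, thetaSum_zero] at h
    simp only [add_mul, one_mul, mul_assoc, map_add, map_sub, map_mul, map_one,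
      constantCoeff_X, h]
    field_simp
    ring
  · simp only [add_mul, one_mul, mul_assoc, map_add, map_sub, coeff_C_mul, coeff_succ_X_mul,
      coeff_zero_X_mul, coeff_rescale, value_coeff hq0, thetaSum_succ hq0, thetaSum_zero,
      coeff_one]
    field_simp
    simp
    ring
  · simp only [add_mul, one_mul, mul_assoc, map_add, map_sub, coeff_C_mul, coeff_succ_X_mul,
      coeff_rescale, value_coeff hq0, thetaSum_succ hq0, coeff_one, coeff_X]
    field_simp
    simp
    ring

/-- The difference of two solutions is `X` times an expression in itself and its dilation, so its
coefficients vanish inductively. -/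
theorem eq_of_functional {q : K} {f g : K⟦X⟧} {p : K⟦X⟧}
    (hf : (1 + C (q ^ 2) * X) * f = C (q ^ 3) * X * (1 + X) * rescale (q ^ 2) f + p)
    (hg : (1 + C (q ^ 2) * X) * g = C (q ^ 3) * X * (1 + X) * rescale (q ^ 2) g + p) :
    f = g := by
  have hd : (1 + C (q ^ 2) * X) * (f - g) =
      C (q ^ 3) * X * (1 + X) * rescale (q ^ 2) (f - g) := by
    rw [map_sub]
    linear_combination hf - hg
  rw [← sub_eq_zero]
  generalize f - g = d at hd
  have e : d = X * (C (q ^ 3) * (rescale (q ^ 2) d + X * rescale (q ^ 2) d) - C (q ^ 2) * d) := by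
    linear_combination hd
  ext N
  induction N using Nat.strong_induction_on with
  | _ N ih =>
    rw [e]
    rcases N with _ | _ | N
    · simp
    · have h0 := ih 0 (by omega)
      simp only [coeff_succ_X_mul, map_sub, map_add, coeff_C_mul, coeff_rescale,
        coeff_zero_X_mul, h0, map_zero]
      ring
    · have h0 := ih N (by omega)
      have h1 := ih (N + 1) (by omega)
      simp only [coeff_succ_X_mul, map_sub, map_add, coeff_C_mul, coeff_rescale, h0, h1, map_zero]
      ring

theorem tailSeq_one_eq_value {q : K} (hq0 : q ≠ 0) (hq1 : q ≠ 1) :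
    tailSeq (coef q) 1 = value q :=
  eq_of_functional (tailSeq_one_functional q) (value_functional hq0 hq1)

/-! ### Convergence of the convergents -/

theorem contFrac_get? (q : K) (n : ℕ) :
    (contFrac q).s.get? n = some ⟨partialNum q n, 1 + v K⟩ := rfl

/-- Constant term `1` makes the denominators units of `K⟦X⟧`, so dividing the error by them keeps
its factor `v ^ n`. -/
theorem contFrac_dens (q : K) (n : ℕ) :
    ∃ B : K⟦X⟧, constantCoeff B = 1 ∧ (contFrac q).dens n = (B : K⸨X⸩) := by
  induction n using Nat.twoStepInduction with
  | zero => exact ⟨1, by simp, by simp⟩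
  | one => exact ⟨1 + X, by simp, by
      rw [GenContFract.first_den_eq (contFrac_get? q 0)]; simp [v]⟩
  | more n ih0 ih1 =>
    obtain ⟨B0, h0, e0⟩ := ih0
    obtain ⟨B1, h1, e1⟩ := ih1
    refine ⟨(1 + X) * B1 - C (coef q (n + 1)) * X * B0, by simp [h1], ?_⟩
    rw [GenContFract.dens_recurrence (contFrac_get? q (n + 1)) e0 e1]
    simp only [partialNum, v, PowerSeries.coe_sub, PowerSeries.coe_mul, PowerSeries.coe_add,
      PowerSeries.coe_one, PowerSeries.coe_C]
    ring

/-- Both sides obey the three-term recurrence of the convergents. -/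
theorem contFrac_error (q : K) (n : ℕ) :
    ((tailSeq (coef q) 1 : K⟦X⟧) : K⸨X⸩) * (contFrac q).dens n - (contFrac q).nums n =
      HahnSeries.C (∏ i ∈ Finset.range n, coef q (i + 1)) * v K ^ n *
        ((tailSeq (coef q) (n + 1) : K⟦X⟧) : K⸨X⸩) := by
  have hrec : ∀ k, ((tailSeq (coef q) k : K⟦X⟧) : K⸨X⸩) =
      (1 + v K) * ((tailSeq (coef q) (k + 1) : K⟦X⟧) : K⸨X⸩) -
        HahnSeries.C (coef q (k + 1)) * v K * ((tailSeq (coef q) (k + 2) : K⟦X⟧) : K⸨X⸩) := by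
    intro k
    rw [isTailSeq_tailSeq (coef q) k]
    simp only [v, PowerSeries.coe_sub, PowerSeries.coe_mul, PowerSeries.coe_add,
      PowerSeries.coe_one, PowerSeries.coe_C]
  induction n using Nat.twoStepInduction with
  | zero => simp [contFrac]
  | one =>
    rw [GenContFract.first_den_eq (contFrac_get? q 0),
      GenContFract.first_num_eq (contFrac_get? q 0)]
    have h := hrec 0
    rw [tailSeq_zero, PowerSeries.coe_one] at h
    simp only [contFrac, partialNum, Finset.prod_range_one, pow_one]
    linear_combination -h
  | more n ih0 ih1 =>
    rw [GenContFract.dens_recurrence (contFrac_get? q (n + 1)) rfl rfl,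
      GenContFract.nums_recurrence (contFrac_get? q (n + 1)) rfl rfl]
    have h := hrec (n + 1)
    simp only [Finset.prod_range_succ, map_mul, partialNum, pow_succ] at ih0 ih1 ⊢
    linear_combination (1 + v K) * ih1 - HahnSeries.C (coef q (n + 1)) * v K * ih0
      - HahnSeries.C (∏ i ∈ Finset.range n, coef q (i + 1)) * HahnSeries.C (coef q (n + 1)) *
        v K ^ n * v K * h

theorem tendsto_of_sub_eq_X_pow_mul {u : ℕ → K⸨X⸩} {l : K⸨X⸩}
    (h : ∀ n, ∃ f : K⟦X⟧, u n - l = ((X ^ n * f : K⟦X⟧) : K⸨X⸩)) : Tendsto u atTop (𝓝 l) := by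
  intro U hU
  obtain ⟨γ, hγ⟩ := Valued.mem_nhds.mp hU
  set g : WithZero (Multiplicative ℤ) := MonoidWithZeroHom.ValueGroup₀.embedding γ.1 with hg
  have hg0 : g ≠ 0 := by simp [hg]
  obtain ⟨m, hm⟩ : ∃ m : ℕ, -WithZero.log g < m := ⟨(-WithZero.log g).toNat + 1, by omega⟩
  change ∀ᶠ n in atTop, u n ∈ U
  filter_upwards [eventually_ge_atTop m] with n hn
  apply hγ
  rw [Set.mem_ofPred_eq, Valuation.restrict_lt_iff_lt_embedding]
  obtain ⟨f, hf⟩ := h n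
  have hle : Valued.v (u n - l) ≤ WithZero.exp (-(n : ℤ)) := by
    rw [hf, LaurentSeries.intValuation_le_iff_coeff_lt_eq_zero]
    exact fun k hk => PowerSeries.X_pow_dvd_iff.1 (Dvd.intro _ rfl) k hk
  refine hle.trans_lt ?_
  rw [← WithZero.lt_log_iff_exp_lt hg0]
  omega

theorem tendsto_convs (q : K) :
    Tendsto (fun n : ℕ => (contFrac q).convs n) atTop
      (𝓝 ((tailSeq (coef q) 1 : K⟦X⟧) : K⸨X⸩)) := by
  refine tendsto_of_sub_eq_X_pow_mul fun n => ?_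
  obtain ⟨B, hB1, hB⟩ := contFrac_dens q n
  have hB0 : constantCoeff B ≠ 0 := by simp [hB1]
  have hinv : (B : K⸨X⸩) * ((B⁻¹ : K⟦X⟧) : K⸨X⸩) = 1 := by
    rw [← PowerSeries.coe_mul, PowerSeries.mul_inv_cancel B hB0, PowerSeries.coe_one]
  have hBne : (B : K⸨X⸩) ≠ 0 := left_ne_zero_of_mul_eq_one hinv
  refine ⟨-(C (∏ i ∈ Finset.range n, coef q (i + 1)) * tailSeq (coef q) (n + 1) * B⁻¹), ?_⟩
  have he := contFrac_error q n
  rw [GenContFract.conv_eq_num_div_den, hB, div_sub' hBne, div_eq_iff hBne]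
  rw [hB] at he
  simp only [v, PowerSeries.coe_mul, PowerSeries.coe_neg, PowerSeries.coe_pow,
    PowerSeries.coe_C] at he ⊢
  linear_combination -he + HahnSeries.C (∏ i ∈ Finset.range n, coef q (i + 1)) *
    ((X : K⟦X⟧) : K⸨X⸩) ^ n * ((tailSeq (coef q) (n + 1) : K⟦X⟧) : K⸨X⸩) * hinv

end TouchardCF

/-- The convergents of the continued fraction converge in `K((v))`, with its `v`-adic topology
(equivalently: every coefficient is eventually constant), to the stated series. -/
theorem mainTheorem8 {K : Type*} [Field K] (q : K) (hq0 : q ≠ 0) (hq1 : q ≠ 1) :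
    Tendsto (fun n : ℕ => (TouchardCF.contFrac q).convs n) atTop
      (𝓝 ((PowerSeries.C (1 / (1 - q)) * TouchardCF.firstSeries q
        - PowerSeries.C (1 / (1 - q)) * TouchardCF.secondSeries q : K⟦X⟧) : K⸨X⸩)) := by
  have h := TouchardCF.tendsto_convs q
  rwa [TouchardCF.tailSeq_one_eq_value hq0 hq1, TouchardCF.value] at h
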